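/- Let $t_0<t_f$, $A\in\mathbb R^{n\times n}$, $B\in\mathbb R^{n\times m}$ of full column rank $m$, $Q\succeq 0$ and $F\succ 0$ in $\mathbb R^{n\times n}$, and $R\succ 0$ in $\mathbb R^{m\times m}$. A linear-quadratic regulator $$\min_u\; x(t_f)^TFx(t_f)+\int_{t_0}^{t_f}(x^TQx+u^TRu)\,dt,\qquad \dot x=Ax+Bu,\quad x(t_0)=x_0,$$ whose coefficients $A,B,Q,R$ may depend continuously on $t\in[t_0,t_f]$, with $Q(t)\succeq0$, $R(t)\succ0$, $F\succeq0$, is said to have Riccati solution $P$ and optimal feedback matrix $K$ if on $[t_0,t_f]$ $$\dot P=-A^TP-PA+PBR^{-1}B^TP-Q,\quad P(t_f)=F,\qquad K(t)=-R^{-1}B^TP(t).$$ LQR-A is this problem with the constant data $(A,B,Q,R,F)$ fixed above; $P$ and $K$ denote its Riccati solution and its optimal feedback matrix. LQR-B is the problem with state $z\in\mathbb R^m$, control $v\in\mathbb R^n$, dynamics $\dot z=K(t)v$, and costs $\bar F=R$, $\bar Q(t)=B^TP(t)B$, $\bar R(t)=P(t)$. (0) For all $t\in[t_0,t_f]$: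 $\operatorname{rank}K(t)=m$, $\bar R(t)\succ0$ and $\bar Q(t)\succ0$. The Riccati equation of LQR-B has the unique solution $\bar P(t)\equiv R$, and its optimal feedback matrix is the constant matrix $B$. Moreover, for every initial state $z_0$ the feedback $v=Bz$ gives a minimizer of LQR-B among all square-integrable controls, unique up to null sets. (1) Consider the inverse problem for LQR-A with $(A,B)$, $K$, $Q$, $F$ given: find the matrices $R'\succ0$ such that the LQR with data $(A,B,Q,R',F)$ has optimal feedback matrix $K$. Consider also the inverse problem for LQR-B with dynamics $K(t)$, feedback matrix $B$ and control cost $\bar R=P$ given: find the Riccati solutions $\bar P$ for those remaining costs for which $B$ is the optimal feedback matrix; here either $\bar Q=B^TPB$ is also given and the terminal cost is unknown, or $\bar F=R$ is also given and the state cost is unknown, or both are unknown. In each of these three variants, $\bar P$ is a solution if and only if $\bar P(t)\equiv R'$ on $[t_0,t_f]$ for a solution $R'$ of the LQR-A problem. The only such $R'$ is $R$. (2) Conversely, consider the inverse problem for LQR-B with dynamics $K(t)$, feedback matrix $B$ and the costs $\bar Q=B^TPB$, $\bar F=R$ given: find the continuous control costs $S(t)\succ0$ on $[t_0,t_f]$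 for which $B$ is the optimal feedback matrix. A function $S$ is a solution if and only if it is continuous on $[t_0,t_f]$ and satisfies $S(t)\succ0$ and $B^TS(t)=-RK(t)$ there, that is, if and only if it lies in the solution space of positive definite $P(t)$ compatible with $K$ and the given $R$ in LQR-A. Furthermore: (2a) $S$ is the Riccati solution of the LQR with data $(A,B,Q,R,F')$ for some $F'\succ0$, with optimal feedback matrix $K$, if and only if $S$ solves the above inverse problem for LQR-B and $S$ is the Riccati solution for $(A,B,Q,R,F')$ for some $F'\succeq0$. (2b) $S$ is the Riccati solution of the LQR with data $(A,B,Q',R,F)$ for some constant $Q'\succeq0$, with optimal feedback matrix $K$, if and only if $S$ solves the above inverse problem for LQR-B and $S$ is the Riccati solution for $(A,B,Q',R,F)$ for some constant $Q'\succeq0$. -/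

import Mathlib

open Matrix Set MeasureTheory

/-- A finite-horizon linear-quadratic regulator with (possibly) time-varying data:
minimise `x(t_f)ᵀ F x(t_f) + ∫ (xᵀ Q x + uᵀ R u)` subject to `x' = A x + B u` on `[t₀, t_f]`,
with state in `ℝⁿ` and control in `ℝᵐ`. -/
structure LQR (n m : ℕ) where
  t₀ : ℝ
  t_f : ℝ
  A : ℝ → Matrix (Fin n) (Fin n) ℝ
  B : ℝ → Matrix (Fin n) (Fin m) ℝ
  Q : ℝ → Matrix (Fin n) (Fin n) ℝ
  R : ℝ → Matrix (Fin m) (Fin m) ℝ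
  F : Matrix (Fin n) (Fin n) ℝ

namespace LQR

variable {n m : ℕ} (L : LQR n m)

/-- The time horizon `[t₀, t_f]`. -/
def horizon : Set ℝ := Icc L.t₀ L.t_f

/-- The standing assumptions on the data of a regulator: nondegenerate horizon, continuous
coefficients, `Q(t) ⪰ 0`, `F ⪰ 0` and `R(t) ≻ 0`. -/
structure IsRegular : Prop where
  lt : L.t₀ < L.t_f
  contA : ContinuousOn L.A L.horizon
  contB : ContinuousOn L.B L.horizon
  contQ : ContinuousOn L.Q L.horizon
  contR : ContinuousOn L.R L.horizon
  psdQ : ∀ t ∈ L.horizon, (L.Q t).PosSemidef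
  pdR : ∀ t ∈ L.horizon, (L.R t).PosDef
  psdF : L.F.PosSemidef

/-- `P` solves the differential Riccati equation
`P' = -AᵀP - PA + P B R⁻¹ Bᵀ P - Q` on `[t₀, t_f]` with `P(t_f) = F`
(the derivative is taken entrywise, one-sided at the end points). -/
def IsRiccatiSolution (P : ℝ → Matrix (Fin n) (Fin n) ℝ) : Prop :=
  (∀ t ∈ L.horizon, ∀ i j : Fin n,
    HasDerivWithinAt (fun s => P s i j)
      ((-((L.A t)ᵀ * P t) - P t * L.A t
          + P t * L.B t * (L.R t)⁻¹ * (L.B t)ᵀ * P t - L.Q t) i j)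
      L.horizon t) ∧
  P L.t_f = L.F

/-- The feedback matrix `-R(t)⁻¹ B(t)ᵀ P(t)`. -/
noncomputable def gain (P : ℝ → Matrix (Fin n) (Fin n) ℝ) (t : ℝ) : Matrix (Fin m) (Fin n) ℝ :=
  -((L.R t)⁻¹ * (L.B t)ᵀ * P t)

/-- The regulator `L` has Riccati solution `P` and optimal feedback matrix
`K(t) = -R(t)⁻¹ B(t)ᵀ P(t)` on `[t₀, t_f]`. -/
structure Generates (P : ℝ → Matrix (Fin n) (Fin n) ℝ) (K : ℝ → Matrix (Fin m) (Fin n) ℝ) :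
    Prop where
  regular : L.IsRegular
  riccati : L.IsRiccatiSolution P
  feedback : ∀ t ∈ L.horizon, K t = L.gain P t

/-- `x` is the trajectory started at `x₀` under the square-integrable control `u`
(integral form of `x' = A x + B u`, `x(t₀) = x₀`). -/
structure IsTrajectory (x₀ : Fin n → ℝ) (u : ℝ → Fin m → ℝ) (x : ℝ → Fin n → ℝ) : Prop where
  control : ∀ j, MemLp (fun t => u t j) 2 (volume.restrict L.horizon)
  cont : ContinuousOn x L.horizon
  eqn : ∀ t ∈ L.horizon, ∀ i,
    x t i = x₀ i + ∫ s in L.t₀..t, (L.A s *ᵥ x s + L.B s *ᵥ u s) i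

/-- The quadratic cost. -/
noncomputable def cost (u : ℝ → Fin m → ℝ) (x : ℝ → Fin n → ℝ) : ℝ :=
  x L.t_f ⬝ᵥ (L.F *ᵥ x L.t_f)
    + ∫ t in L.t₀..L.t_f, (x t ⬝ᵥ (L.Q t *ᵥ x t) + u t ⬝ᵥ (L.R t *ᵥ u t))

/-- The feedback law `u(t) = K(t) x(t)` yields, for each initial state, a minimiser of the cost
over all square-integrable controls, and any other minimiser agrees with it almost everywhere. -/
def IsOptimalFeedback (K : ℝ → Matrix (Fin m) (Fin n) ℝ) : Prop :=
  ∀ x₀ : Fin n → ℝ, ∃ (u : ℝ → Fin m → ℝ) (x : ℝ → Fin n → ℝ),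
    L.IsTrajectory x₀ u x ∧ (∀ t ∈ L.horizon, u t = K t *ᵥ x t) ∧
    ∀ (u' : ℝ → Fin m → ℝ) (x' : ℝ → Fin n → ℝ), L.IsTrajectory x₀ u' x' →
      L.cost u x ≤ L.cost u' x' ∧
      (L.cost u' x' = L.cost u x → ∀ᵐ t ∂(volume.restrict L.horizon), u' t = u t)

end LQR

/-- LQR-A: the time-invariant regulator `x' = A x + B u` with constant costs `Q`, `R`, `F`. -/
def lqrA {n m : ℕ} (t₀ t_f : ℝ) (A : Matrix (Fin n) (Fin n) ℝ) (B : Matrix (Fin n) (Fin m) ℝ)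
    (Q : Matrix (Fin n) (Fin n) ℝ) (R : Matrix (Fin m) (Fin m) ℝ)
    (F : Matrix (Fin n) (Fin n) ℝ) : LQR n m :=
  ⟨t₀, t_f, fun _ => A, fun _ => B, fun _ => Q, fun _ => R, F⟩

/-- LQR-B: the time-varying regulator `z' = K(t) v` with state in `ℝᵐ`, control in `ℝⁿ` and costs
`Qb(t)`, `Rb(t)`, `Fb`. -/
def lqrB {n m : ℕ} (t₀ t_f : ℝ) (K : ℝ → Matrix (Fin m) (Fin n) ℝ)
    (Qb : ℝ → Matrix (Fin m) (Fin m) ℝ) (Rb : ℝ → Matrix (Fin n) (Fin n) ℝ)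
    (Fb : Matrix (Fin m) (Fin m) ℝ) : LQR m n :=
  ⟨t₀, t_f, fun _ => 0, K, Qb, Rb, Fb⟩

section InverseProblems

variable {n m : ℕ} (t₀ t_f : ℝ)

/-- Inverse problem for LQR-A, state and terminal costs given: `R` is a control cost for which
`K` is the optimal feedback matrix. -/
def SolvesOneA (A : Matrix (Fin n) (Fin n) ℝ) (B : Matrix (Fin n) (Fin m) ℝ)
    (K : ℝ → Matrix (Fin m) (Fin n) ℝ) (Q F : Matrix (Fin n) (Fin n) ℝ)
    (R : Matrix (Fin m) (Fin m) ℝ) : Prop :=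
  ∃ P, (lqrA t₀ t_f A B Q R F).Generates P K

/-- Inverse problem for LQR-A, `R` and `Q` given: `P` is the Riccati solution for some terminal
cost for which `K` is the optimal feedback matrix. -/
def SolvesTwoAGivenQ (A : Matrix (Fin n) (Fin n) ℝ) (B : Matrix (Fin n) (Fin m) ℝ)
    (K : ℝ → Matrix (Fin m) (Fin n) ℝ) (R : Matrix (Fin m) (Fin m) ℝ)
    (Q : Matrix (Fin n) (Fin n) ℝ) (P : ℝ → Matrix (Fin n) (Fin n) ℝ) : Prop :=
  ∃ F, (lqrA t₀ t_f A B Q R F).Generates P K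

/-- Inverse problem for LQR-A, `R` and `F` given: `P` is the Riccati solution for some (constant)
state cost for which `K` is the optimal feedback matrix. -/
def SolvesTwoAGivenF (A : Matrix (Fin n) (Fin n) ℝ) (B : Matrix (Fin n) (Fin m) ℝ)
    (K : ℝ → Matrix (Fin m) (Fin n) ℝ) (R : Matrix (Fin m) (Fin m) ℝ)
    (F : Matrix (Fin n) (Fin n) ℝ) (P : ℝ → Matrix (Fin n) (Fin n) ℝ) : Prop :=
  ∃ Q, (lqrA t₀ t_f A B Q R F).Generates P K

/-- Inverse problem for LQR-B, state and terminal costs given: `Rb` is a control cost for which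
`B` is the optimal feedback matrix. -/
def SolvesOneB (K : ℝ → Matrix (Fin m) (Fin n) ℝ) (B : Matrix (Fin n) (Fin m) ℝ)
    (Qb : ℝ → Matrix (Fin m) (Fin m) ℝ) (Fb : Matrix (Fin m) (Fin m) ℝ)
    (Rb : ℝ → Matrix (Fin n) (Fin n) ℝ) : Prop :=
  ∃ Pb, (lqrB t₀ t_f K Qb Rb Fb).Generates Pb (fun _ => B)

/-- Inverse problem for LQR-B, control and state costs given: `Pb` is the Riccati solution for
some terminal cost for which `B` is the optimal feedback matrix. -/
def SolvesTwoBGivenQ (K : ℝ → Matrix (Fin m) (Fin n) ℝ) (B : Matrix (Fin n) (Fin m) ℝ)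
    (Rb : ℝ → Matrix (Fin n) (Fin n) ℝ) (Qb : ℝ → Matrix (Fin m) (Fin m) ℝ)
    (Pb : ℝ → Matrix (Fin m) (Fin m) ℝ) : Prop :=
  ∃ Fb, (lqrB t₀ t_f K Qb Rb Fb).Generates Pb (fun _ => B)

/-- Inverse problem for LQR-B, control and terminal costs given: `Pb` is the Riccati solution for
some state cost for which `B` is the optimal feedback matrix. -/
def SolvesTwoBGivenF (K : ℝ → Matrix (Fin m) (Fin n) ℝ) (B : Matrix (Fin n) (Fin m) ℝ)
    (Rb : ℝ → Matrix (Fin n) (Fin n) ℝ) (Fb : Matrix (Fin m) (Fin m) ℝ)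
    (Pb : ℝ → Matrix (Fin m) (Fin m) ℝ) : Prop :=
  ∃ Qb, (lqrB t₀ t_f K Qb Rb Fb).Generates Pb (fun _ => B)

/-- Inverse problem for LQR-B with only the control cost given. -/
def SolvesTwoBGivenROnly (K : ℝ → Matrix (Fin m) (Fin n) ℝ) (B : Matrix (Fin n) (Fin m) ℝ)
    (Rb : ℝ → Matrix (Fin n) (Fin n) ℝ) (Pb : ℝ → Matrix (Fin m) (Fin m) ℝ) : Prop :=
  ∃ Qb Fb, (lqrB t₀ t_f K Qb Rb Fb).Generates Pb (fun _ => B)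

end InverseProblems

/-! Clearing inverses, the feedback law of LQR-A reads `Bᵀ P = -R K`. As `P` and `R` are symmetric,
its transpose is `P B = -Kᵀ R`, the feedback law of LQR-B with control cost `P`, Riccati solution
`R` and gain `B`. This one relation carries the duality. It also gives `R K P⁻¹ Kᵀ R = Bᵀ P B`, so
the constant `R` solves the Riccati equation of LQR-B (`lqrB_generates`), and completing the square
gives optimality (`lqrB_isOptimalFeedback`). Invertibility of `P` comes from
`LQR.IsRiccatiSolution.posDef`.

Recovering `R'` in LQR-A is decided at `t_f`, where every candidate Riccati solution equals `F`.
Recovering the Riccati solution of LQR-B is pointwise linear algebra, since `B` is injective.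
Recovering a control cost `S` of LQR-B needs analysis (`solvesOneB_iff`): the law `S B = -Kᵀ Pb`
turns the Riccati equation into a linear one for `Pb - R`, with terminal value zero. Hence `Pb = R`,
and `S` obeys the same linear relation as `P`. In (2a) and (2b) that relation and positivity are
what a bare Riccati solution has to satisfy in addition. -/

section LinearODE

/-! ### Linear differential equations in a normed space -/

variable {E : Type*} [NormedAddCommGroup E] [NormedSpace ℝ E]

theorem exists_opNorm_bound_Icc {a b : ℝ} {L : ℝ → E →L[ℝ] E} (hL : ContinuousOn L (Icc a b)) :
    ∃ C : NNReal, ∀ t ∈ Icc a b, ‖L t‖ ≤ C := by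
  obtain ⟨C, hC⟩ := isCompact_Icc.exists_bound_of_continuousOn hL
  exact ⟨C.toNNReal, fun t ht => (hC t ht).trans (Real.le_coe_toNNReal C)⟩

theorem linearODE_eq_zero_of_left {a b : ℝ} {L : ℝ → E →L[ℝ] E} (hL : ContinuousOn L (Icc a b))
    {D : ℝ → E} (hD : ∀ t ∈ Icc a b, HasDerivWithinAt D (L t (D t)) (Icc a b) t)
    (h0 : D a = 0) : ∀ t ∈ Icc a b, D t = 0 := by
  obtain ⟨C, hC⟩ := exists_opNorm_bound_Icc hL
  exact eq_zero_of_abs_deriv_le_mul_abs_self_of_eq_zero_right (K := C)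
    (HasDerivWithinAt.continuousOn hD)
    (fun t ht => (hD t (Ico_subset_Icc_self ht)).mono_of_mem_nhdsWithin
      (Icc_mem_nhdsGE_of_mem ht)) h0
    (fun t ht => (L t).le_of_opNorm_le (hC t (Ico_subset_Icc_self ht)) _)

theorem linearODE_eq_zero_of_right {a b : ℝ} {L : ℝ → E →L[ℝ] E} (hL : ContinuousOn L (Icc a b))
    {D : ℝ → E} (hD : ∀ t ∈ Icc a b, HasDerivWithinAt D (L t (D t)) (Icc a b) t)
    (h0 : D b = 0) : ∀ t ∈ Icc a b, D t = 0 := by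
  obtain ⟨C, hC⟩ := exists_opNorm_bound_Icc hL
  exact ODE_solution_unique_of_mem_Icc_left (v := fun t => L t) (s := fun _ => univ) (K := C)
    (g := fun _ => 0)
    (fun t ht => ((L t).lipschitz.weaken (hC t (Ioc_subset_Icc_self ht))).lipschitzOnWith)
    (HasDerivWithinAt.continuousOn hD)
    (fun t ht => (hD t (Ioc_subset_Icc_self ht)).mono_of_mem_nhdsWithin
      (Icc_mem_nhdsLE_of_mem ht)) (fun _ _ => mem_univ _) continuousOn_const
    (fun t _ => by simpa using hasDerivWithinAt_const t (Iic t) (0 : E)) (fun _ _ => mem_univ _) h0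

/-- Picard iteration on the whole interval at once. The unknown is `w(t) = exp(-l(t-a)) y(t)`; this
weight makes the integral operator a contraction with factor `C / l`, whatever the length of the
interval. -/
theorem linearODE_exists [CompleteSpace E] {a b : ℝ} (hab : a ≤ b) {L : ℝ → E →L[ℝ] E}
    (hL : ContinuousOn L (Icc a b)) (y₀ : E) :
    ∃ y : ℝ → E, y a = y₀ ∧ ∀ t ∈ Icc a b, HasDerivAt y (L t (y t)) t := by
  obtain ⟨C, hC⟩ := exists_opNorm_bound_Icc hL
  -- Extending the coefficient by its end values makes the integrand continuous on the line, so the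
  -- derivative is two-sided even at `a` and `b`.
  let G : ℝ → E →L[ℝ] E := IccExtend hab ((Icc a b).domRestrict L)
  have hG : Continuous G := (continuousOn_iff_continuous_domRestrict.1 hL).Icc_extend'
  have hGC : ∀ t, ‖G t‖ ≤ C := fun t => hC _ (projIcc a b hab t).2
  have hGL : ∀ t ∈ Icc a b, G t = L t := fun t ht => IccExtend_of_mem hab _ ht
  -- The factor 2 gives the contraction constant 1/2; the added 1 keeps `l` positive when `C = 0`.
  let l : ℝ := 2 * C + 1
  have hl : 0 < l := by positivity
  let h : C(Icc a b, E) → ℝ → E := fun w s => Real.exp (l * (s - a)) • G s (IccExtend hab w s)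
  have hh : ∀ w, Continuous (h w) := fun w =>
    (by fun_prop : Continuous fun s : ℝ => Real.exp (l * (s - a))).smul
      (hG.clm_apply (w.continuous.Icc_extend'))
  let Y : C(Icc a b, E) → ℝ → E := fun w t => y₀ + ∫ s in a..t, h w s
  have hY : ∀ w t, HasDerivAt (Y w) (h w t) t := fun w t =>
    ((hh w).integral_hasStrictDerivAt a t).hasDerivAt.const_add y₀
  have hYc : ∀ w, Continuous (Y w) := fun w =>
    continuous_iff_continuousAt.2 fun t => (hY w t).continuousAt
  let T : C(Icc a b, E) → C(Icc a b, E) := fun w =>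
    ⟨fun t => Real.exp (-(l * (t - a))) • Y w t, by
      have := hYc w
      fun_prop⟩
  have hTc : ContractingWith (1 / 2) T := by
    refine ⟨by norm_num, LipschitzWith.of_dist_le_mul fun w w' => ?_⟩
    rw [ContinuousMap.dist_le (by positivity)]
    rintro ⟨t, ht⟩
    have hexp : ∀ s : ℝ, HasDerivAt (fun s : ℝ => Real.exp (l * (s - a)) * (C * dist w w' / l))
        (Real.exp (l * (s - a)) * (C * dist w w')) s := fun s => by
      have := (((hasDerivAt_id s).sub_const a).const_mul l).exp.mul_const (C * dist w w' / l)
      refine this.congr_deriv ?_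
      field_simp
      simp only [id]
      ring
    have hgc : Continuous fun s : ℝ => Real.exp (l * (s - a)) * (C * dist w w') := by fun_prop
    have hdiff : Y w t - Y w' t = ∫ s in a..t, (h w s - h w' s) := by
      rw [intervalIntegral.integral_sub ((hh w).intervalIntegrable _ _)
        ((hh w').intervalIntegrable _ _)]
      simp [Y]
    have hbound : ‖Y w t - Y w' t‖ ≤ ∫ s in a..t, Real.exp (l * (s - a)) * (C * dist w w') := by
      rw [hdiff]
      refine intervalIntegral.norm_integral_le_of_norm_le ht.1 (ae_of_all _ fun s _ => ?_)
        (hgc.intervalIntegrable _ _)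
      simp only [h]
      rw [← smul_sub, ← map_sub, norm_smul, Real.norm_eq_abs, Real.abs_exp]
      gcongr
      refine ((G s).le_of_opNorm_le (hGC s) _).trans ?_
      gcongr
      rw [← dist_eq_norm]
      exact ContinuousMap.dist_apply_le_dist _
    rw [intervalIntegral.integral_eq_sub_of_hasDerivAt (fun s _ => hexp s)
      (hgc.intervalIntegrable _ _)] at hbound
    have hCl : C * dist w w' / l ≤ 1 / 2 * dist w w' := by
      rw [div_le_iff₀ hl]
      simp only [l]
      nlinarith [dist_nonneg (x := w) (y := w')]
    have hpos : 0 ≤ C * dist w w' / l := by positivity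
    calc dist (T w ⟨t, ht⟩) (T w' ⟨t, ht⟩)
        = Real.exp (-(l * (t - a))) * ‖Y w t - Y w' t‖ := by
          rw [dist_eq_norm, ← Real.abs_exp, ← Real.norm_eq_abs, ← norm_smul, smul_sub]
          rfl
      _ ≤ Real.exp (-(l * (t - a))) * (Real.exp (l * (t - a)) * (C * dist w w' / l)) := by
          gcongr
          refine hbound.trans (sub_le_self _ (by positivity))
      _ = C * dist w w' / l := by
          rw [← mul_assoc, ← Real.exp_add]
          simp
      _ ≤ _ := by simpa using hCl
  obtain ⟨w, hw⟩ : ∃ w, T w = w := ⟨_, hTc.fixedPoint_isFixedPt⟩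
  refine ⟨Y w, by simp [Y], fun t ht => ?_⟩
  convert hY w t using 1
  have h1 : IccExtend hab w t = Real.exp (-(l * (t - a))) • Y w t := by
    rw [IccExtend_of_mem hab _ ht]
    exact (DFunLike.congr_fun hw ⟨t, ht⟩).symm
  simp only [h, h1, hGL t ht, map_smul, smul_smul, ← Real.exp_add]
  simp

end LinearODE

/-! ### Linear matrix and vector equations -/

section MatrixODE

theorem matrix_linearODE_eq_zero {n m : ℕ} {a b : ℝ} {M : ℝ → Matrix (Fin n) (Fin n) ℝ}
    {N : ℝ → Matrix (Fin m) (Fin m) ℝ} (hM : ContinuousOn M (Icc a b))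
    (hN : ContinuousOn N (Icc a b)) {D : ℝ → Matrix (Fin n) (Fin m) ℝ}
    (hD : ∀ t ∈ Icc a b, ∀ i j,
      HasDerivWithinAt (fun s => D s i j) ((M t * D t + D t * N t) i j) (Icc a b) t)
    (h0 : D b = 0) : ∀ t ∈ Icc a b, D t = 0 := by
  let A : ℝ → Matrix (Fin n) (Fin m) ℝ →ₗ[ℝ] Matrix (Fin n) (Fin m) ℝ := fun t =>
    { toFun := fun X => M t * X + X * N t
      map_add' := fun X Y => by simp only [Matrix.mul_add, Matrix.add_mul]; abel
      map_smul' := fun c X => by simp }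
  -- Matrices are read as functions with the sup norm, for which entrywise differentiability is
  -- differentiability.
  let L : ℝ → (Fin n → Fin m → ℝ) →L[ℝ] (Fin n → Fin m → ℝ) := fun t =>
    LinearMap.toContinuousLinearMap (E := Fin n → Fin m → ℝ) (F' := Fin n → Fin m → ℝ) (A t)
  have hL : ContinuousOn L (Icc a b) := by
    rw [continuousOn_clm_apply]
    intro X
    change ContinuousOn (fun t => M t * of X + of X * N t) (Icc a b)
    fun_prop
  exact linearODE_eq_zero_of_right hL (D := D)
    (fun t ht => hasDerivWithinAt_pi.2 fun i => hasDerivWithinAt_pi.2 fun j => hD t ht i j) h0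

end MatrixODE

theorem linearODE_mulVec_exists {n : ℕ} {a b : ℝ} (hab : a ≤ b)
    {G : ℝ → Matrix (Fin n) (Fin n) ℝ} (hG : ContinuousOn G (Icc a b)) (y₀ : Fin n → ℝ) :
    ∃ y : ℝ → Fin n → ℝ, y a = y₀ ∧ ∀ t ∈ Icc a b, HasDerivAt y (G t *ᵥ y t) t := by
  let L : ℝ → (Fin n → ℝ) →L[ℝ] (Fin n → ℝ) := fun t =>
    LinearMap.toContinuousLinearMap (G t).mulVecLin
  have hL : ContinuousOn L (Icc a b) := by
    rw [continuousOn_clm_apply]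
    intro X
    change ContinuousOn (fun t => G t *ᵥ X) (Icc a b)
    fun_prop
  exact linearODE_exists hab hL y₀

theorem linearODE_mulVec_eq_zero {n : ℕ} {a b : ℝ}
    {G : ℝ → Matrix (Fin n) (Fin n) ℝ} (hG : ContinuousOn G (Icc a b)) {y : ℝ → Fin n → ℝ}
    (hy : ∀ t ∈ Icc a b, HasDerivWithinAt y (G t *ᵥ y t) (Icc a b) t) (h : y a = 0 ∨ y b = 0) :
    ∀ t ∈ Icc a b, y t = 0 := by
  let L : ℝ → (Fin n → ℝ) →L[ℝ] (Fin n → ℝ) := fun t =>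
    LinearMap.toContinuousLinearMap (G t).mulVecLin
  have hL : ContinuousOn L (Icc a b) := by
    rw [continuousOn_clm_apply]
    intro X
    change ContinuousOn (fun t => G t *ᵥ X) (Icc a b)
    fun_prop
  exact h.elim (linearODE_eq_zero_of_left hL hy) (linearODE_eq_zero_of_right hL hy)

/-! ### Positive definite matrices -/

theorem Matrix.PosDef.isSymm {n : ℕ} {M : Matrix (Fin n) (Fin n) ℝ} (h : M.PosDef) : Mᵀ = M := by
  simpa using h.isHermitian.eq

theorem Matrix.PosSemidef.isSymm {n : ℕ} {M : Matrix (Fin n) (Fin n) ℝ} (h : M.PosSemidef) :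
    Mᵀ = M := by
  simpa using h.isHermitian.eq

theorem Matrix.PosDef.isUnit_det' {n : ℕ} {M : Matrix (Fin n) (Fin n) ℝ} (h : M.PosDef) :
    IsUnit M.det :=
  h.det_pos.ne'.isUnit

theorem ContinuousOn.matrix_inv_of_posDef {n : ℕ} {s : Set ℝ} {R : ℝ → Matrix (Fin n) (Fin n) ℝ}
    (h : ContinuousOn R s) (hR : ∀ t ∈ s, (R t).PosDef) : ContinuousOn (fun t => (R t)⁻¹) s := by
  rw [continuousOn_iff_continuous_domRestrict] at h ⊢
  have hdet : Continuous fun t : s => ((R t).det)⁻¹ :=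
    h.matrix_det.inv₀ fun t => (hR t t.2).det_pos.ne'
  refine (hdet.smul h.matrix_adjugate).congr fun t => ?_
  simp [Matrix.inv_def]

/-! ### The Riccati equation: uniqueness, symmetry, positivity -/

namespace LQR

variable {n m : ℕ} {L : LQR n m}

/-- The quadratic coefficient `B R⁻¹ Bᵀ` of the Riccati equation. -/
noncomputable def quadCoeff (L : LQR n m) (t : ℝ) : Matrix (Fin n) (Fin n) ℝ :=
  L.B t * (L.R t)⁻¹ * (L.B t)ᵀ

theorem IsRegular.continuousOn_quadCoeff (hL : L.IsRegular) :
    ContinuousOn L.quadCoeff L.horizon := by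
  have := hL.contR.matrix_inv_of_posDef hL.pdR
  have := hL.contB
  unfold quadCoeff
  fun_prop

theorem IsRegular.transpose_quadCoeff (hL : L.IsRegular) {t : ℝ} (ht : t ∈ L.horizon) :
    (L.quadCoeff t)ᵀ = L.quadCoeff t := by
  simp [quadCoeff, transpose_mul, transpose_nonsing_inv, (hL.pdR t ht).isSymm, Matrix.mul_assoc]

theorem IsRegular.right_mem (hL : L.IsRegular) : L.t_f ∈ L.horizon :=
  ⟨hL.lt.le, le_rfl⟩

namespace IsRiccatiSolution

variable {P P' : ℝ → Matrix (Fin n) (Fin n) ℝ}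

theorem hasDerivWithinAt (hP : L.IsRiccatiSolution P) {t : ℝ} (ht : t ∈ L.horizon) (i j : Fin n) :
    HasDerivWithinAt (fun s => P s i j)
      ((-((L.A t)ᵀ * P t) - P t * L.A t + P t * L.quadCoeff t * P t - L.Q t) i j)
      L.horizon t := by
  simpa only [quadCoeff, Matrix.mul_assoc] using hP.1 t ht i j

theorem continuousOn (hP : L.IsRiccatiSolution P) : ContinuousOn P L.horizon :=
  continuousOn_pi.2 fun i => continuousOn_pi.2 fun j =>
    HasDerivWithinAt.continuousOn fun _ ht => hP.hasDerivWithinAt ht i j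

theorem congr (hP : L.IsRiccatiSolution P) (hL : L.IsRegular)
    (h : ∀ t ∈ L.horizon, P' t = P t) : L.IsRiccatiSolution P' := by
  refine ⟨fun t ht i j => ?_, (h _ hL.right_mem).trans hP.2⟩
  rw [h t ht]
  exact (hP.1 t ht i j).congr (fun s hs => by rw [h s hs]) (by rw [h t ht])

/-- With `M = B R⁻¹ Bᵀ`, the identity `P M P - P' M P' = P M (P - P') + (P - P') M P'` makes the
difference of two solutions solve a linear equation with zero terminal value. -/
theorem eqOn (hL : L.IsRegular) (hP : L.IsRiccatiSolution P) (hP' : L.IsRiccatiSolution P') :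
    ∀ t ∈ L.horizon, P t = P' t := by
  have hM := hL.continuousOn_quadCoeff
  have hA := hL.contA
  have hPc := hP.continuousOn
  have hPc' := hP'.continuousOn
  have key := matrix_linearODE_eq_zero (a := L.t₀) (b := L.t_f)
    (M := fun t => -(L.A t)ᵀ + P t * L.quadCoeff t)
    (N := fun t => -L.A t + L.quadCoeff t * P' t) (D := fun t => P t - P' t)
    (by change ContinuousOn _ L.horizon; fun_prop) (by change ContinuousOn _ L.horizon; fun_prop)
    (fun t ht i j => ?_) (by simp [hP.2, hP'.2])
  · exact fun t ht => sub_eq_zero.1 (key t ht)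
  · refine ((hP.hasDerivWithinAt ht i j).fun_sub (hP'.hasDerivWithinAt ht i j)).congr_deriv ?_
    refine (Matrix.sub_apply _ _ i j).symm.trans (congrFun (congrFun ?_ i) j)
    noncomm_ring

theorem transpose (hL : L.IsRegular) (hP : L.IsRiccatiSolution P) :
    L.IsRiccatiSolution fun t => (P t)ᵀ := by
  refine ⟨fun t ht i j => ?_, ?_⟩
  · refine (hP.hasDerivWithinAt ht j i).congr_deriv ?_
    refine (Matrix.transpose_apply _ i j).symm.trans (congrFun (congrFun ?_ i) j)
    simp only [transpose_sub, transpose_add, transpose_neg, transpose_mul, transpose_transpose,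
      hL.transpose_quadCoeff ht, (hL.psdQ t ht).isSymm]
    simp only [quadCoeff, Matrix.mul_assoc]
    abel
  · simp [hP.2, hL.psdF.isSymm]

theorem isSymm (hL : L.IsRegular) (hP : L.IsRiccatiSolution P) {t : ℝ} (ht : t ∈ L.horizon) :
    (P t)ᵀ = P t :=
  (hP.transpose hL).eqOn hL hP t ht

/-- Along a suitable linear flow `y` starting from `v` at time `t`, the form `yᵀ P y` has derivative
`-yᵀ Q y ≤ 0`, so its initial value is at least its terminal value `y(t_f)ᵀ F y(t_f) > 0`. -/
theorem posDef (hL : L.IsRegular) (hF : L.F.PosDef) (hP : L.IsRiccatiSolution P) {t : ℝ}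
    (ht : t ∈ L.horizon) : (P t).PosDef := by
  refine .of_dotProduct_mulVec_pos (by simpa [Matrix.IsHermitian] using hP.isSymm hL ht) fun {v} hv => ?_
  have hsub : Icc t L.t_f ⊆ L.horizon := Icc_subset_Icc_left ht.1
  have hM := hL.continuousOn_quadCoeff
  have hA := hL.contA
  have hPc := hP.continuousOn
  -- The factor 1/2 makes `Gᵀ P + P G` absorb the quadratic term of the Riccati equation exactly,
  -- leaving `-Q`.
  let G : ℝ → Matrix (Fin n) (Fin n) ℝ := fun s => L.A s - (1 / 2 : ℝ) • (L.quadCoeff s * P s)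
  have hG : ContinuousOn G (Icc t L.t_f) :=
    ContinuousOn.mono (s := L.horizon) (by fun_prop) hsub
  obtain ⟨y, hy0, hy⟩ := linearODE_mulVec_exists ht.2 hG v
  have hyf : y L.t_f ≠ 0 := fun h => hv <| hy0 ▸ linearODE_mulVec_eq_zero hG
    (fun s hs => (hy s hs).hasDerivWithinAt) (Or.inr h) t ⟨le_rfl, ht.2⟩
  let f : ℝ → ℝ := fun s => y s ⬝ᵥ (P s *ᵥ y s)
  have hf : ∀ s ∈ Icc t L.t_f,
      HasDerivWithinAt f (-(y s ⬝ᵥ (L.Q s *ᵥ y s))) (Icc t L.t_f) s := by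
    intro s hs
    have hPs := fun i j => (hP.hasDerivWithinAt (hsub hs) i j).mono hsub
    have hys := (hy s hs).hasDerivWithinAt (s := Icc t L.t_f)
    set P1 := -((L.A s)ᵀ * P s) - P s * L.A s + P s * L.quadCoeff s * P s - L.Q s
    have h1 : HasDerivWithinAt f
        ((G s *ᵥ y s) ⬝ᵥ (P s *ᵥ y s) + y s ⬝ᵥ (P1 *ᵥ y s + P s *ᵥ (G s *ᵥ y s)))
        (Icc t L.t_f) s := by
      rw [hasDerivWithinAt_pi] at hys
      simp only [f, dotProduct, mulVec, Pi.add_apply, ← Finset.sum_add_distrib]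
      refine HasDerivWithinAt.fun_sum fun i _ => (hys i).fun_mul ?_
      exact HasDerivWithinAt.fun_sum fun j _ => (hPs i j).fun_mul (hys j)
    refine h1.congr_deriv ?_
    have h2 : (G s)ᵀ * P s + P1 + P s * G s = - L.Q s := by
      simp only [G, P1, transpose_sub, transpose_smul, transpose_mul,
        hL.transpose_quadCoeff (hsub hs), hP.isSymm hL (hsub hs), Matrix.sub_mul, Matrix.mul_sub,
        Matrix.smul_mul, Matrix.mul_smul, Matrix.mul_assoc]
      module
    have h3 : ∀ w, (G s *ᵥ y s) ⬝ᵥ w = y s ⬝ᵥ ((G s)ᵀ *ᵥ w) := fun w => by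
      rw [dotProduct_mulVec, vecMul_transpose]
    rw [h3, ← dotProduct_add, mulVec_mulVec,
      mulVec_mulVec, ← add_mulVec, ← add_mulVec, ← add_assoc, h2, neg_mulVec, dotProduct_neg]
  have hanti : AntitoneOn f (Icc t L.t_f) := by
    refine antitoneOn_of_hasDerivWithinAt_nonpos (convex_Icc _ _)
      (HasDerivWithinAt.continuousOn hf)
      (fun s hs => (hf s (interior_subset hs)).mono interior_subset) fun s hs => ?_
    simpa using (hL.psdQ s (hsub (interior_subset hs))).dotProduct_mulVec_nonneg (y s)
  have hpos : 0 < f L.t_f := by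
    simpa [f, hP.2] using hF.dotProduct_mulVec_pos hyf
  have hle := hanti ⟨le_rfl, ht.2⟩ ⟨ht.2, le_rfl⟩ ht.2
  simpa [f, hy0] using hpos.trans_le hle

end IsRiccatiSolution

end LQR

/-! ### Integration along trajectories with square-integrable controls -/

/-- This integrates `(zᵀ R z)' = 2 zᵀ R z'`. Since `g` is only integrable, the product rule is used
entrywise for absolutely continuous functions, with derivatives almost everywhere. -/
theorem integral_two_mul_dotProduct_mulVec {m : ℕ} {a b : ℝ} (hab : a ≤ b)
    {R : Matrix (Fin m) (Fin m) ℝ} (hR : Rᵀ = R) {z g : ℝ → Fin m → ℝ} {z₀ : Fin m → ℝ}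
    (hg : ∀ i, IntervalIntegrable (fun t => g t i) volume a b)
    (hz : ∀ t ∈ Icc a b, ∀ i, z t i = z₀ i + ∫ s in a..t, g s i) :
    IntervalIntegrable (fun t => 2 * (z t ⬝ᵥ (R *ᵥ g t))) volume a b ∧
      ∫ t in a..b, 2 * (z t ⬝ᵥ (R *ᵥ g t)) = z b ⬝ᵥ (R *ᵥ z b) - z₀ ⬝ᵥ (R *ᵥ z₀) := by
  let Z : Fin m → ℝ → ℝ := fun i t => z₀ i + ∫ s in a..t, g s i
  have hZ : ∀ i, AbsolutelyContinuousOnInterval (Z i) a b := fun i =>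
    (contDiffOn_const.absolutelyContinuousOnInterval (f := fun _ => z₀ i)).fun_add
      ((hg i).absolutelyContinuousOnInterval_intervalIntegral left_mem_uIcc)
  have hZ' : ∀ i, ∀ᵐ t, t ∈ uIoc a b → deriv (Z i) t = g t i := fun i => by
    filter_upwards [(hg i).ae_hasDerivAt_integral] with t ht hmem
    exact ((ht (uIoc_subset_uIcc hmem) a left_mem_uIcc).const_add (z₀ i)).deriv
  have hint : ∀ i j, IntervalIntegrable (fun t => g t i * Z j t + Z i t * g t j) volume a b :=
    fun i j => ((hg i).mul_continuousOn (hZ j).continuousOn).add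
      ((hg j).continuousOn_mul (hZ i).continuousOn)
  have hprod : ∀ i j, ∫ t in a..b, (g t i * Z j t + Z i t * g t j)
      = z b i * z b j - z₀ i * z₀ j := fun i j => by
    have h := (hZ i).integral_deriv_mul_eq_sub (hZ j)
    rw [hz b ⟨hab, le_rfl⟩, hz b ⟨hab, le_rfl⟩]
    refine Eq.trans (intervalIntegral.integral_congr_ae ?_) (h.trans (by simp [Z]))
    filter_upwards [hZ' i, hZ' j] with t h1 h2 ht
    rw [h1 ht, h2 ht]
  have hpt : ∀ t ∈ uIcc a b, ∑ i, ∑ j, R i j * (g t i * Z j t + Z i t * g t j)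
      = 2 * (z t ⬝ᵥ (R *ᵥ g t)) := fun t ht => by
    rw [uIcc_of_le hab] at ht
    have hsymm : z t ⬝ᵥ (R *ᵥ g t) = g t ⬝ᵥ (R *ᵥ z t) := by
      rw [dotProduct_mulVec, ← mulVec_transpose, hR, dotProduct_comm]
    rw [two_mul]
    nth_rw 1 [hsymm]
    simp only [dotProduct, mulVec, Finset.mul_sum, ← Finset.sum_add_distrib]
    refine Finset.sum_congr rfl fun i _ => Finset.sum_congr rfl fun j _ => ?_
    rw [hz t ht i, hz t ht j]
    simp only [Z]
    ring
  have hsum_row : ∀ i, IntervalIntegrable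
      (fun t => ∑ j, R i j * (g t i * Z j t + Z i t * g t j)) volume a b := fun i => by
    simpa only [Finset.sum_fn] using
      IntervalIntegrable.sum Finset.univ fun j _ => (hint i j).const_mul (R i j)
  have hsum : IntervalIntegrable
      (fun t => ∑ i, ∑ j, R i j * (g t i * Z j t + Z i t * g t j)) volume a b := by
    simpa only [Finset.sum_fn] using IntervalIntegrable.sum Finset.univ fun i _ => hsum_row i
  constructor
  · exact hsum.congr (fun t ht => hpt t (uIoc_subset_uIcc ht))
  · rw [← intervalIntegral.integral_congr (fun t ht => hpt t ht),
      intervalIntegral.integral_finsetSum fun i _ => hsum_row i]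
    simp_rw [intervalIntegral.integral_finsetSum fun j _ => (hint _ j).const_mul (R _ j),
      intervalIntegral.integral_const_mul, hprod]
    simp only [dotProduct, mulVec, Finset.mul_sum, ← Finset.sum_sub_distrib]
    exact Finset.sum_congr rfl fun i _ => Finset.sum_congr rfl fun j _ => by ring

theorem ContinuousOn.memLp_restrict_Icc {a b : ℝ} {f : ℝ → ℝ} (hf : ContinuousOn f (Icc a b))
    {p : ENNReal} : MemLp f p (volume.restrict (Icc a b)) := by
  obtain ⟨C, hC⟩ := isCompact_Icc.exists_bound_of_continuousOn hf
  exact MemLp.of_bound (hf.aestronglyMeasurable measurableSet_Icc) C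
    ((ae_restrict_iff' measurableSet_Icc).2 (ae_of_all _ hC))

theorem intervalIntegrable_quadratic_form {n : ℕ} {a b : ℝ} (hab : a ≤ b)
    {P : ℝ → Matrix (Fin n) (Fin n) ℝ} (hP : ContinuousOn P (Icc a b)) {w : ℝ → Fin n → ℝ}
    (hw : ∀ j, MemLp (fun t => w t j) 2 (volume.restrict (Icc a b))) :
    IntervalIntegrable (fun t => w t ⬝ᵥ (P t *ᵥ w t)) volume a b := by
  rw [intervalIntegrable_iff_integrableOn_Icc_of_le hab]
  have h : ∀ i j, IntegrableOn (fun t => P t i j * (w t i * w t j)) (Icc a b) := fun i j =>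
    IntegrableOn.continuousOn_mul
      (((continuous_apply_apply i j).comp_continuousOn hP :)) ((hw i).integrable_mul (hw j))
      isCompact_Icc
  refine (integrable_finsetSum Finset.univ fun i _ =>
    integrable_finsetSum Finset.univ fun j _ => h i j).congr
    (ae_of_all _ fun t => ?_)
  simp only [dotProduct, mulVec, Finset.mul_sum]
  exact Finset.sum_congr rfl fun i _ => Finset.sum_congr rfl fun j _ => by ring

theorem intervalIntegrable_mulVec_apply {n m : ℕ} {a b : ℝ} (hab : a ≤ b)
    {K : ℝ → Matrix (Fin m) (Fin n) ℝ} (hK : ContinuousOn K (Icc a b)) {v : ℝ → Fin n → ℝ}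
    (hv : ∀ j, MemLp (fun t => v t j) 2 (volume.restrict (Icc a b))) (i : Fin m) :
    IntervalIntegrable (fun t => (K t *ᵥ v t) i) volume a b := by
  rw [intervalIntegrable_iff_integrableOn_Icc_of_le hab]
  have h : ∀ j, IntegrableOn (fun t => K t i j * v t j) (Icc a b) := fun j =>
    IntegrableOn.continuousOn_mul
      (((continuous_apply_apply i j).comp_continuousOn hK :))
      ((hv j).integrable one_le_two) isCompact_Icc
  exact integrable_finsetSum Finset.univ fun j _ => h j

/-! ### Completion of the square and optimality in LQR-B -/

section CompleteSquare

variable {n m : ℕ} {t₀ t_f : ℝ} {K : ℝ → Matrix (Fin m) (Fin n) ℝ} {B : Matrix (Fin n) (Fin m) ℝ}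
  {P : ℝ → Matrix (Fin n) (Fin n) ℝ} {R : Matrix (Fin m) (Fin m) ℝ}
  {z₀ : Fin m → ℝ} {v : ℝ → Fin n → ℝ} {z : ℝ → Fin m → ℝ}

theorem lqrB_trajectory_eqn {Qb : ℝ → Matrix (Fin m) (Fin m) ℝ}
    (h : (lqrB t₀ t_f K Qb P R).IsTrajectory z₀ v z) :
    ∀ t ∈ Icc t₀ t_f, ∀ i, z t i = z₀ i + ∫ s in t₀..t, (K s *ᵥ v s) i := by
  intro t ht i
  simpa [lqrB] using h.eqn t ht i

/-- The cross term `-2 (B z)ᵀ P v` of the square equals `2 zᵀ R K v = (zᵀ R z)'` along `z' = K v`;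
its integral cancels the terminal cost and leaves the initial value. -/
theorem lqrB_cost_eq (hlt : t₀ < t_f) (hKc : ContinuousOn K (Icc t₀ t_f))
    (hPc : ContinuousOn P (Icc t₀ t_f)) (hP : ∀ t ∈ Icc t₀ t_f, (P t)ᵀ = P t) (hR : Rᵀ = R)
    (hPK : ∀ t ∈ Icc t₀ t_f, Bᵀ * P t = -(R * K t))
    (h : (lqrB t₀ t_f K (fun t => Bᵀ * P t * B) P R).IsTrajectory z₀ v z) :
    IntervalIntegrable (fun t => (v t - B *ᵥ z t) ⬝ᵥ (P t *ᵥ (v t - B *ᵥ z t))) volume t₀ t_f ∧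
    (lqrB t₀ t_f K (fun t => Bᵀ * P t * B) P R).cost v z = z₀ ⬝ᵥ (R *ᵥ z₀)
      + ∫ t in t₀..t_f, (v t - B *ᵥ z t) ⬝ᵥ (P t *ᵥ (v t - B *ᵥ z t)) := by
  have hv : ∀ j, MemLp (fun t => v t j) 2 (volume.restrict (Icc t₀ t_f)) := h.control
  have hzc : ContinuousOn z (Icc t₀ t_f) := h.cont
  have hw : ∀ j, MemLp (fun t => (v t - B *ᵥ z t) j) 2 (volume.restrict (Icc t₀ t_f)) :=
    fun j => (hv j).sub (ContinuousOn.memLp_restrict_Icc (by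
      have : ContinuousOn (fun t => B *ᵥ z t) (Icc t₀ t_f) := by fun_prop
      exact continuousOn_pi.1 this j))
  have hint := intervalIntegrable_quadratic_form hlt.le hPc hw
  obtain ⟨hint', hquad⟩ := integral_two_mul_dotProduct_mulVec hlt.le hR
    (intervalIntegrable_mulVec_apply hlt.le hKc hv) (lqrB_trajectory_eqn h)
  refine ⟨hint, ?_⟩
  have hpt : ∀ t ∈ uIcc t₀ t_f,
      z t ⬝ᵥ ((Bᵀ * P t * B) *ᵥ z t) + v t ⬝ᵥ (P t *ᵥ v t)
        = (v t - B *ᵥ z t) ⬝ᵥ (P t *ᵥ (v t - B *ᵥ z t)) - 2 * (z t ⬝ᵥ (R *ᵥ (K t *ᵥ v t))) := by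
    intro t ht
    rw [uIcc_of_le hlt.le] at ht
    have h1 : z t ⬝ᵥ (R *ᵥ (K t *ᵥ v t)) = -((B *ᵥ z t) ⬝ᵥ (P t *ᵥ v t)) := by
      rw [mulVec_mulVec, ← neg_eq_iff_eq_neg.2 (hPK t ht), neg_mulVec, dotProduct_neg,
        ← mulVec_mulVec, dotProduct_mulVec, vecMul_transpose]
    have h2 : z t ⬝ᵥ ((Bᵀ * P t * B) *ᵥ z t) = (B *ᵥ z t) ⬝ᵥ (P t *ᵥ (B *ᵥ z t)) := by
      rw [← mulVec_mulVec, ← mulVec_mulVec, dotProduct_mulVec, vecMul_transpose]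
    have h3 : v t ⬝ᵥ (P t *ᵥ (B *ᵥ z t)) = (B *ᵥ z t) ⬝ᵥ (P t *ᵥ v t) := by
      rw [dotProduct_mulVec, ← mulVec_transpose, hP t ht, dotProduct_comm]
    rw [h1, h2, mulVec_sub, dotProduct_sub, sub_dotProduct, sub_dotProduct, h3]
    ring
  have hcost : ∫ t in t₀..t_f, (z t ⬝ᵥ ((Bᵀ * P t * B) *ᵥ z t) + v t ⬝ᵥ (P t *ᵥ v t))
      = (∫ t in t₀..t_f, (v t - B *ᵥ z t) ⬝ᵥ (P t *ᵥ (v t - B *ᵥ z t)))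
        - (z t_f ⬝ᵥ (R *ᵥ z t_f) - z₀ ⬝ᵥ (R *ᵥ z₀)) := by
    rw [intervalIntegral.integral_congr hpt, intervalIntegral.integral_sub hint hint', hquad]
  change z t_f ⬝ᵥ (R *ᵥ z t_f) + ∫ t in t₀..t_f,
    (z t ⬝ᵥ ((Bᵀ * P t * B) *ᵥ z t) + v t ⬝ᵥ (P t *ᵥ v t)) = _
  rw [hcost]
  ring

theorem hasDerivWithinAt_of_eq_add_integral {G : ℝ → Matrix (Fin m) (Fin m) ℝ}
    (hlt : t₀ ≤ t_f) (hG : ContinuousOn G (Icc t₀ t_f)) (hz : ContinuousOn z (Icc t₀ t_f))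
    (h : ∀ t ∈ Icc t₀ t_f, ∀ i, z t i = z₀ i + ∫ s in t₀..t, (G s *ᵥ z s) i) :
    ∀ t ∈ Icc t₀ t_f, HasDerivWithinAt z (G t *ᵥ z t) (Icc t₀ t_f) t := by
  intro t ht
  rw [hasDerivWithinAt_pi]
  intro i
  have hc : ContinuousOn (fun s => (G s *ᵥ z s) i) (Icc t₀ t_f) :=
    continuousOn_pi.1 (by fun_prop : ContinuousOn (fun s => G s *ᵥ z s) (Icc t₀ t_f)) i
  -- A right-hand side that ignores the state reduces this to the fundamental theorem of calculus,
  -- one-sided at the end points.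
  have := ODE.hasDerivWithinAt_picard_Icc (f := fun s (_ : ℝ) => (G s *ᵥ z s) i) (u := univ)
    (α := fun _ => 0) (t₀ := t₀) ⟨le_rfl, hlt⟩
    (by exact hc.comp continuousOn_fst (fun _ h => h.1)) continuousOn_const
    (fun _ _ => mem_univ _) (z₀ i) ht
  exact this.congr (fun s hs => h s hs i) (h t ht i)

theorem lqrB_isOptimalFeedback (hlt : t₀ < t_f) (hKc : ContinuousOn K (Icc t₀ t_f))
    (hPc : ContinuousOn P (Icc t₀ t_f)) (hP : ∀ t ∈ Icc t₀ t_f, (P t).PosDef) (hR : Rᵀ = R)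
    (hPK : ∀ t ∈ Icc t₀ t_f, Bᵀ * P t = -(R * K t)) :
    (lqrB t₀ t_f K (fun t => Bᵀ * P t * B) P R).IsOptimalFeedback (fun _ => B) := by
  intro z₀
  have hG : ContinuousOn (fun t => K t * B) (Icc t₀ t_f) := by fun_prop
  have hPs : ∀ t ∈ Icc t₀ t_f, (P t)ᵀ = P t := fun t ht => (hP t ht).isSymm
  obtain ⟨z, hz0, hz⟩ := linearODE_mulVec_exists hlt.le hG z₀
  have hzc : ContinuousOn z (Icc t₀ t_f) := fun t ht => (hz t ht).continuousAt.continuousWithinAt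
  have hBz : ContinuousOn (fun t => B *ᵥ z t) (Icc t₀ t_f) := by fun_prop
  have hKBz : ContinuousOn (fun t => (K t * B) *ᵥ z t) (Icc t₀ t_f) := by fun_prop
  have htraj : (lqrB t₀ t_f K (fun t => Bᵀ * P t * B) P R).IsTrajectory z₀
      (fun t => B *ᵥ z t) z := by
    refine ⟨fun j => (continuousOn_pi.1 hBz j).memLp_restrict_Icc, hzc, fun t (ht : t ∈ Icc t₀ t_f) i => ?_⟩
    have hsub : uIcc t₀ t ⊆ Icc t₀ t_f := by
      rw [uIcc_of_le ht.1]
      exact Icc_subset_Icc_right ht.2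
    have h := intervalIntegral.integral_eq_sub_of_hasDerivAt
      (fun s hs => hasDerivAt_pi.1 (hz s (hsub hs)) i)
      ((continuousOn_pi.1 hKBz i).mono hsub).intervalIntegrable
    simp only [lqrB, zero_mulVec, zero_add, mulVec_mulVec]
    rw [h, hz0]
    ring
  refine ⟨fun t => B *ᵥ z t, z, htraj, fun _ _ => rfl, fun v' z' h' => ?_⟩
  have hc := (lqrB_cost_eq hlt hKc hPc hPs hR hPK htraj).2
  obtain ⟨hint, hc'⟩ := lqrB_cost_eq hlt hKc hPc hPs hR hPK h'
  simp only [sub_self, zero_dotProduct, intervalIntegral.integral_zero, add_zero] at hc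
  have hnonneg : ∀ t ∈ Icc t₀ t_f, 0 ≤ (v' t - B *ᵥ z' t) ⬝ᵥ (P t *ᵥ (v' t - B *ᵥ z' t)) :=
    fun t ht => by simpa using (hP t ht).posSemidef.dotProduct_mulVec_nonneg (v' t - B *ᵥ z' t)
  rw [hc, hc']
  refine ⟨le_add_of_nonneg_right (intervalIntegral.integral_nonneg hlt.le hnonneg), fun heq => ?_⟩
  -- Equal cost forces the nonnegative square to vanish almost everywhere. Then `z'` solves the same
  -- closed-loop equation as `z` with the same initial value, so the controls agree too.
  have hae : ∀ᵐ t ∂volume.restrict (Icc t₀ t_f), v' t = B *ᵥ z' t := by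
    have h0 := add_eq_left.1 heq
    rw [intervalIntegral.integral_of_le hlt.le, ← integral_Icc_eq_integral_Ioc,
      integral_eq_zero_iff_of_nonneg_ae
        ((ae_restrict_iff' measurableSet_Icc).2 (ae_of_all _ hnonneg))
        ((intervalIntegrable_iff_integrableOn_Icc_of_le hlt.le).1 hint)] at h0
    filter_upwards [h0, ae_restrict_mem measurableSet_Icc] with t h1 ht
    by_contra hne
    have := (hP t ht).dotProduct_mulVec_pos (sub_ne_zero.2 hne)
    simp only [star_trivial] at this
    exact this.ne' h1
  have hzc' : ContinuousOn z' (Icc t₀ t_f) := h'.cont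
  have hz' := hasDerivWithinAt_of_eq_add_integral (z₀ := z₀) hlt.le hG hzc' fun t ht i => by
    rw [lqrB_trajectory_eqn h' t ht i]
    congr 1
    refine intervalIntegral.integral_congr_ae ?_
    filter_upwards [(ae_restrict_iff' measurableSet_Icc).1 hae] with s hs hmem
    rw [uIoc_of_le ht.1] at hmem
    rw [hs ⟨hmem.1.le, hmem.2.trans ht.2⟩, mulVec_mulVec]
  have hz0' : z' t₀ = z₀ := funext fun i => by
    simpa using lqrB_trajectory_eqn h' t₀ ⟨le_rfl, hlt.le⟩ i
  have hdiff := linearODE_mulVec_eq_zero (y := fun t => z' t - z t) hG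
    (fun t ht => ((hz' t ht).fun_sub (hz t ht).hasDerivWithinAt).congr_deriv
      (mulVec_sub _ _ _).symm) (Or.inl (by simp [hz0, hz0']))
  filter_upwards [hae, ae_restrict_mem measurableSet_Icc] with t h1 ht
  rw [h1, sub_eq_zero.1 (hdiff t ht)]

end CompleteSquare

/-! ### Rank cancellation and the feedback laws in linear form -/

theorem Matrix.mulVec_injective_of_rank_eq {n m : ℕ} {B : Matrix (Fin n) (Fin m) ℝ}
    (hB : B.rank = m) : Function.Injective B.mulVec := by
  rw [Matrix.mulVec_injective_iff, linearIndependent_iff_card_eq_finrank_span,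
    Set.finrank, ← Matrix.rank_eq_finrank_span_cols, hB, Fintype.card_fin]

theorem Matrix.mul_left_cancel_of_rank_eq {n m k : ℕ} {B : Matrix (Fin n) (Fin m) ℝ}
    (hB : B.rank = m) {X Y : Matrix (Fin m) (Fin k) ℝ} (h : B * X = B * Y) : X = Y := by
  refine Matrix.ext_of_mulVec_single fun j => Matrix.mulVec_injective_of_rank_eq hB ?_
  simp only [mulVec_mulVec, h]

theorem Matrix.mul_transpose_right_cancel_of_rank_eq {n m k : ℕ} {B : Matrix (Fin n) (Fin m) ℝ}
    (hB : B.rank = m) {X Y : Matrix (Fin k) (Fin m) ℝ} (h : X * Bᵀ = Y * Bᵀ) : X = Y := by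
  refine Matrix.transpose_injective (Matrix.mul_left_cancel_of_rank_eq hB ?_)
  simpa [transpose_mul] using congrArg transpose h

theorem lqrA_feedback_iff {n m : ℕ} {t₀ t_f : ℝ} {A : Matrix (Fin n) (Fin n) ℝ}
    {B : Matrix (Fin n) (Fin m) ℝ} {Q F : Matrix (Fin n) (Fin n) ℝ} {R : Matrix (Fin m) (Fin m) ℝ}
    {P : ℝ → Matrix (Fin n) (Fin n) ℝ} {M : Matrix (Fin m) (Fin n) ℝ} (hR : R.PosDef) (t : ℝ) :
    M = (lqrA t₀ t_f A B Q R F).gain P t ↔ Bᵀ * P t = -(R * M) := by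
  have hu := hR.isUnit_det'
  change M = -(R⁻¹ * Bᵀ * P t) ↔ _
  constructor
  · rintro rfl
    rw [Matrix.mul_neg, neg_neg, Matrix.mul_assoc, mul_nonsing_inv_cancel_left _ _ hu]
  · intro h
    rw [Matrix.mul_assoc, h, Matrix.mul_neg, neg_neg, nonsing_inv_mul_cancel_left _ _ hu]

theorem lqrB_feedback_iff {n m : ℕ} {t₀ t_f : ℝ} {K : ℝ → Matrix (Fin m) (Fin n) ℝ}
    {B : Matrix (Fin n) (Fin m) ℝ} {Qb Pb : ℝ → Matrix (Fin m) (Fin m) ℝ}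
    {S : ℝ → Matrix (Fin n) (Fin n) ℝ} {Fb : Matrix (Fin m) (Fin m) ℝ} {t : ℝ}
    (hS : (S t).PosDef) :
    B = (lqrB t₀ t_f K Qb S Fb).gain Pb t ↔ S t * B = -((K t)ᵀ * Pb t) := by
  have hu := hS.isUnit_det'
  change B = -((S t)⁻¹ * (K t)ᵀ * Pb t) ↔ _
  constructor
  · intro h
    conv_lhs => rw [h]
    rw [Matrix.mul_neg, Matrix.mul_assoc, mul_nonsing_inv_cancel_left _ _ hu]
  · intro h
    rw [Matrix.mul_assoc, eq_neg_iff_add_eq_zero.1 h |> eq_neg_of_add_eq_zero_right,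
      Matrix.mul_neg, neg_neg, nonsing_inv_mul_cancel_left _ _ hu]

/-! ### Duality between LQR-A and LQR-B -/

section Duality

variable {n m : ℕ} {t₀ t_f : ℝ} {A : Matrix (Fin n) (Fin n) ℝ} {B : Matrix (Fin n) (Fin m) ℝ}
  {Q F : Matrix (Fin n) (Fin n) ℝ} {R : Matrix (Fin m) (Fin m) ℝ}
  {P S : ℝ → Matrix (Fin n) (Fin n) ℝ} {K : ℝ → Matrix (Fin m) (Fin n) ℝ}

theorem mul_eq_neg_transpose_mul_of_symm {S₁ : Matrix (Fin n) (Fin n) ℝ}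
    {K₁ : Matrix (Fin m) (Fin n) ℝ} (hS : S₁ᵀ = S₁) (hR : Rᵀ = R) :
    Bᵀ * S₁ = -(R * K₁) ↔ S₁ * B = -(K₁ᵀ * R) := by
  rw [← Matrix.transpose_inj]
  simp [transpose_mul, hS, hR]

/-- The state cost is `Bᵀ P B = -R K B`, which depends on `P` only through its relation to `K`.
Hence any compatible `S` may replace `P` as control cost without changing the Riccati solution. -/
theorem lqrB_generates (hlt : t₀ < t_f) (hR : R.PosDef) (hKc : ContinuousOn K (Icc t₀ t_f))
    (hPc : ContinuousOn P (Icc t₀ t_f)) (hP : ∀ t ∈ Icc t₀ t_f, (P t).PosDef)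
    (hPK : ∀ t ∈ Icc t₀ t_f, Bᵀ * P t = -(R * K t))
    (hSc : ContinuousOn S (Icc t₀ t_f)) (hS : ∀ t ∈ Icc t₀ t_f, (S t).PosDef)
    (hSK : ∀ t ∈ Icc t₀ t_f, Bᵀ * S t = -(R * K t)) :
    (lqrB t₀ t_f K (fun t => Bᵀ * P t * B) S R).Generates (fun _ => R) (fun _ => B) where
  regular :=
    { lt := hlt
      contA := continuousOn_const
      contB := hKc
      contQ := by
        change ContinuousOn (fun t => Bᵀ * P t * B) (Icc t₀ t_f)
        fun_prop
      contR := hSc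
      psdQ := fun t ht => by
        simpa [lqrB] using (hP t ht).posSemidef.conjTranspose_mul_mul_same B
      pdR := hS
      psdF := hR.posSemidef }
  riccati := by
    refine ⟨fun t (ht : t ∈ Icc t₀ t_f) i j => (hasDerivWithinAt_const t _ _).congr_deriv ?_, rfl⟩
    have hKR : (K t)ᵀ * R = -(S t * B) := by
      rw [(mul_eq_neg_transpose_mul_of_symm (hS t ht).isSymm hR.isSymm).1 (hSK t ht), neg_neg]
    have hRK : R * K t = -(Bᵀ * P t) := by rw [hPK t ht, neg_neg]
    change (0 : ℝ) = (-((0 : Matrix (Fin m) (Fin m) ℝ)ᵀ * R) - R * (0 : Matrix (Fin m) (Fin m) ℝ)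
      + R * K t * (S t)⁻¹ * (K t)ᵀ * R - Bᵀ * P t * B : Matrix (Fin m) (Fin m) ℝ) i j
    have : R * K t * (S t)⁻¹ * (K t)ᵀ * R = Bᵀ * P t * B := by
      rw [Matrix.mul_assoc _ _ R, hKR, Matrix.mul_neg, Matrix.mul_assoc _ _ (S t * B),
        nonsing_inv_mul_cancel_left _ _ (hS t ht).isUnit_det', hRK, Matrix.neg_mul, neg_neg]
    rw [this]
    simp
  feedback := fun t ht => (lqrB_feedback_iff (hS t ht)).2
    ((mul_eq_neg_transpose_mul_of_symm (hS t ht).isSymm hR.isSymm).1 (hSK t ht))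

theorem LQR.Generates.congr {L : LQR n m} (h : L.Generates P K)
    (hS : ∀ t ∈ L.horizon, S t = P t) : L.Generates S K where
  regular := h.regular
  riccati := h.riccati.congr h.regular hS
  feedback := fun t ht => by rw [h.feedback t ht, LQR.gain, LQR.gain, hS t ht]

/-- Only the feedback law matters: `Kᵀ Pb = Kᵀ R`, and `Kᵀ = -P B R⁻¹` is injective. The same
argument therefore serves all three variants. -/
theorem lqrB_riccatiSolution_eq_of_generates (hB : B.rank = m) (hR : R.PosDef)
    (hP : ∀ t ∈ Icc t₀ t_f, (P t).PosDef) (hPK : ∀ t ∈ Icc t₀ t_f, Bᵀ * P t = -(R * K t))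
    {Qb Pb : ℝ → Matrix (Fin m) (Fin m) ℝ} {Fb : Matrix (Fin m) (Fin m) ℝ}
    (h : (lqrB t₀ t_f K Qb P Fb).Generates Pb (fun _ => B)) :
    ∀ t ∈ Icc t₀ t_f, Pb t = R := by
  intro t ht
  have hu := hR.isUnit_det'
  have h1 : P t * B = -((K t)ᵀ * Pb t) := (lqrB_feedback_iff (hP t ht)).1 (h.feedback t ht)
  have h2 : P t * B = -((K t)ᵀ * R) :=
    (mul_eq_neg_transpose_mul_of_symm (hP t ht).isSymm hR.isSymm).1 (hPK t ht)
  have h3 : (K t)ᵀ = -(P t * B * R⁻¹) := by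
    rw [h2, Matrix.neg_mul, neg_neg, mul_nonsing_inv_cancel_right _ _ hu]
  have h4 : B * (R⁻¹ * Pb t) = B * (1 : Matrix (Fin m) (Fin m) ℝ) := by
    have h5 : P t * (B * (R⁻¹ * Pb t)) = P t * (B * (1 : Matrix (Fin m) (Fin m) ℝ)) := by
      rw [Matrix.mul_one, h1, h3, Matrix.neg_mul, neg_neg]
      simp only [Matrix.mul_assoc]
    simpa [nonsing_inv_mul_cancel_left _ _ (hP t ht).isUnit_det'] using
      congrArg ((P t)⁻¹ * ·) h5
  have h6 := Matrix.mul_left_cancel_of_rank_eq hB h4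
  rw [← mul_nonsing_inv_cancel_left R (Pb t) hu, h6, Matrix.mul_one]

theorem solvesOneB_iff (hlt : t₀ < t_f) (hR : R.PosDef) (hKc : ContinuousOn K (Icc t₀ t_f))
    (hPc : ContinuousOn P (Icc t₀ t_f)) (hP : ∀ t ∈ Icc t₀ t_f, (P t).PosDef)
    (hPK : ∀ t ∈ Icc t₀ t_f, Bᵀ * P t = -(R * K t)) :
    SolvesOneB t₀ t_f K B (fun t => Bᵀ * P t * B) R S ↔
      ContinuousOn S (Icc t₀ t_f) ∧
        ∀ t ∈ Icc t₀ t_f, (S t).PosDef ∧ Bᵀ * S t = -(R * K t) := by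
  constructor
  · rintro ⟨Pb, h⟩
    have hS : ∀ t ∈ Icc t₀ t_f, (S t).PosDef := h.regular.pdR
    have hfb : ∀ t ∈ Icc t₀ t_f, S t * B = -((K t)ᵀ * Pb t) := fun t ht =>
      (lqrB_feedback_iff (hS t ht)).1 (h.feedback t ht)
    -- Substituting `S⁻¹ Kᵀ Pb = -B` and `Bᵀ P B = -R K B` gives `(Pb - R)' = -(Pb - R) K B`.
    have hPb : ∀ t ∈ Icc t₀ t_f, Pb t - R = 0 := by
      refine matrix_linearODE_eq_zero (M := fun _ => 0) (N := fun t => -(K t * B))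
        continuousOn_const (by fun_prop) (fun t ht i j => ?_) (sub_eq_zero.2 h.riccati.2)
      refine ((h.riccati.1 t ht i j).sub_const (R i j)).congr_deriv
        (congrFun (congrFun ?_ i) j)
      have hu := (hS t ht).isUnit_det'
      have h1 : (S t)⁻¹ * ((K t)ᵀ * Pb t) = -B := by
        rw [← neg_eq_iff_eq_neg.2 (hfb t ht), Matrix.mul_neg,
          nonsing_inv_mul_cancel_left _ _ hu]
      have h2 : Bᵀ * P t * B = -(R * (K t * B)) := by
        rw [hPK t ht, Matrix.neg_mul, Matrix.mul_assoc]
      change -((0 : Matrix (Fin m) (Fin m) ℝ)ᵀ * Pb t) - Pb t * 0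
        + Pb t * K t * (S t)⁻¹ * (K t)ᵀ * Pb t - Bᵀ * P t * B = _
      rw [h2]
      simp only [Matrix.mul_assoc, h1, Matrix.sub_mul, Matrix.mul_neg]
      simp
      abel
    refine ⟨h.regular.contR, fun t ht => ⟨hS t ht, ?_⟩⟩
    rw [mul_eq_neg_transpose_mul_of_symm (hS t ht).isSymm hR.isSymm, hfb t ht,
      sub_eq_zero.1 (hPb t ht)]
  · rintro ⟨hSc, hS⟩
    exact ⟨_, lqrB_generates hlt hR hKc hPc hP hPK hSc (fun t ht => (hS t ht).1)
      fun t ht => (hS t ht).2⟩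

/-- At `t_f` both laws give `R' K = -Bᵀ F = R K`; as `F` is invertible and `Bᵀ` is surjective,
`K(t_f)` can be cancelled. -/
theorem solvesOneA_iff (hB : B.rank = m) (hF : F.PosDef)
    (hK : (lqrA t₀ t_f A B Q R F).Generates P K) (R' : Matrix (Fin m) (Fin m) ℝ) :
    SolvesOneA t₀ t_f A B K Q F R' ↔ R' = R := by
  constructor
  · rintro ⟨P', h⟩
    have hf := hK.regular.right_mem
    have hR : R.PosDef := hK.regular.pdR _ hf
    have hR' : R'.PosDef := h.regular.pdR _ hf
    have h1 : Bᵀ * P t_f = -(R * K t_f) := (lqrA_feedback_iff hR t_f).1 (hK.feedback _ hf)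
    have h2 : Bᵀ * P' t_f = -(R' * K t_f) := (lqrA_feedback_iff hR' t_f).1 (h.feedback _ hf)
    rw [show P t_f = F from hK.riccati.2] at h1
    rw [show P' t_f = F from h.riccati.2] at h2
    have h3 : R' * K t_f = R * K t_f := neg_injective (h2.symm.trans h1)
    have h4 : K t_f = -(R⁻¹ * (Bᵀ * F)) := by
      rw [h1, Matrix.mul_neg, neg_neg, nonsing_inv_mul_cancel_left _ _ hR.isUnit_det']
    have h5 : R' * R⁻¹ * Bᵀ = (1 : Matrix (Fin m) (Fin m) ℝ) * Bᵀ := by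
      have h6 : R' * R⁻¹ * Bᵀ * F = Bᵀ * F := by
        rw [h1, ← h3, h4]
        simp only [Matrix.mul_assoc, Matrix.mul_neg, neg_neg]
      rw [Matrix.one_mul, ← mul_nonsing_inv_cancel_right F (R' * R⁻¹ * Bᵀ) hF.isUnit_det', h6,
        mul_nonsing_inv_cancel_right _ _ hF.isUnit_det']
    have h7 := Matrix.mul_transpose_right_cancel_of_rank_eq hB h5
    rw [← nonsing_inv_mul_cancel_right R R' hR.isUnit_det', h7, Matrix.one_mul]
  · rintro rfl
    exact ⟨P, hK⟩

theorem rank_gain_eq (hB : B.rank = m) (hR : R.PosDef) {P₁ : Matrix (Fin n) (Fin n) ℝ}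
    (hP : P₁.PosDef) {K₁ : Matrix (Fin m) (Fin n) ℝ} (h : Bᵀ * P₁ = -(R * K₁)) :
    K₁.rank = m := by
  have h1 : (-R) * K₁ = Bᵀ * P₁ := by rw [h, Matrix.neg_mul]
  have hu : IsUnit (-R).det := by
    rw [Matrix.det_neg]
    exact (IsUnit.pow _ (by simp)).mul hR.isUnit_det'
  rw [← rank_mul_eq_right_of_isUnit_det (-R) K₁ hu, h1,
    rank_mul_eq_left_of_isUnit_det P₁ Bᵀ hP.isUnit_det', rank_transpose, hB]

theorem solvesOneB_of_lqrA_generates (hlt : t₀ < t_f) (hR : R.PosDef)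
    (hKc : ContinuousOn K (Icc t₀ t_f)) (hPc : ContinuousOn P (Icc t₀ t_f))
    (hP : ∀ t ∈ Icc t₀ t_f, (P t).PosDef) (hPK : ∀ t ∈ Icc t₀ t_f, Bᵀ * P t = -(R * K t))
    (hF : F.PosDef) (h : (lqrA t₀ t_f A B Q R F).Generates S K) :
    SolvesOneB t₀ t_f K B (fun t => Bᵀ * P t * B) R S :=
  (solvesOneB_iff hlt hR hKc hPc hP hPK).2 ⟨h.riccati.continuousOn, fun t ht =>
    ⟨h.riccati.posDef h.regular hF ht, (lqrA_feedback_iff hR t).1 (h.feedback t ht)⟩⟩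

end Duality

/-! ### Assembly of the duality theorem -/

theorem mainTheorem11 {n m : ℕ} (t₀ t_f : ℝ)
    (A : Matrix (Fin n) (Fin n) ℝ) (B : Matrix (Fin n) (Fin m) ℝ)
    (Q F : Matrix (Fin n) (Fin n) ℝ) (R : Matrix (Fin m) (Fin m) ℝ)
    (P : ℝ → Matrix (Fin n) (Fin n) ℝ) (K : ℝ → Matrix (Fin m) (Fin n) ℝ)
    (hB : B.rank = m) (hF : F.PosDef)
    (hK : (lqrA t₀ t_f A B Q R F).Generates P K) :
    -- LQR-B with terminal cost `R`, state cost `Bᵀ P B`, control cost `P` is a regular problem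
    (∀ t ∈ Icc t₀ t_f, (K t).rank = m ∧ (P t).PosDef ∧ (Bᵀ * P t * B).PosDef) ∧
    -- its Riccati solution is identically `R`, and its optimal feedback matrix is `B`
    (lqrB t₀ t_f K (fun t => Bᵀ * P t * B) P R).Generates (fun _ => R) (fun _ => B) ∧
    (∀ Pb : ℝ → Matrix (Fin m) (Fin m) ℝ,
      (lqrB t₀ t_f K (fun t => Bᵀ * P t * B) P R).IsRiccatiSolution Pb ↔
        ∀ t ∈ Icc t₀ t_f, Pb t = R) ∧
    (lqrB t₀ t_f K (fun t => Bᵀ * P t * B) P R).IsOptimalFeedback (fun _ => B) ∧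
    -- first equivalence: recovering `R` in LQR-A from `Q`, `F`, and recovering the Riccati
    -- solution of LQR-B from its control cost `P`
    (∀ R' : Matrix (Fin m) (Fin m) ℝ, SolvesOneA t₀ t_f A B K Q F R' ↔ R' = R) ∧
    (∀ Pb : ℝ → Matrix (Fin m) (Fin m) ℝ,
      (SolvesTwoBGivenQ t₀ t_f K B P (fun t => Bᵀ * P t * B) Pb ↔
        ∃ R', SolvesOneA t₀ t_f A B K Q F R' ∧ ∀ t ∈ Icc t₀ t_f, Pb t = R') ∧
      (SolvesTwoBGivenF t₀ t_f K B P R Pb ↔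
        ∃ R', SolvesOneA t₀ t_f A B K Q F R' ∧ ∀ t ∈ Icc t₀ t_f, Pb t = R') ∧
      (SolvesTwoBGivenROnly t₀ t_f K B P Pb ↔
        ∃ R', SolvesOneA t₀ t_f A B K Q F R' ∧ ∀ t ∈ Icc t₀ t_f, Pb t = R')) ∧
    -- second equivalence: recovering the Riccati solution of LQR-A from `R`, and recovering the
    -- control cost of LQR-B from its state cost `Bᵀ P B` and its terminal cost `R`
    (∀ S : ℝ → Matrix (Fin n) (Fin n) ℝ,
      (SolvesOneB t₀ t_f K B (fun t => Bᵀ * P t * B) R S ↔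
        ContinuousOn S (Icc t₀ t_f) ∧
          ∀ t ∈ Icc t₀ t_f, (S t).PosDef ∧ Bᵀ * S t = -(R * K t)) ∧
      (SolvesTwoAGivenQ t₀ t_f A B K R Q S ∧ (S t_f).PosDef ↔
        SolvesOneB t₀ t_f K B (fun t => Bᵀ * P t * B) R S ∧
          ∃ F', (lqrA t₀ t_f A B Q R F').IsRegular ∧
            (lqrA t₀ t_f A B Q R F').IsRiccatiSolution S) ∧
      (SolvesTwoAGivenF t₀ t_f A B K R F S ↔
        SolvesOneB t₀ t_f K B (fun t => Bᵀ * P t * B) R S ∧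
          ∃ Q', (lqrA t₀ t_f A B Q' R F).IsRegular ∧
            (lqrA t₀ t_f A B Q' R F).IsRiccatiSolution S)) := by
  have hreg := hK.regular
  have hlt : t₀ < t_f := hreg.lt
  have hR : R.PosDef := hreg.pdR _ hreg.right_mem
  have hPc : ContinuousOn P (Icc t₀ t_f) := hK.riccati.continuousOn
  have hP : ∀ t ∈ Icc t₀ t_f, (P t).PosDef := fun t ht => hK.riccati.posDef hreg hF ht
  have hPK : ∀ t ∈ Icc t₀ t_f, Bᵀ * P t = -(R * K t) := fun t ht =>
    (lqrA_feedback_iff hR t).1 (hK.feedback t ht)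
  have hKc : ContinuousOn K (Icc t₀ t_f) := by
    refine ContinuousOn.congr (f := fun t => -(R⁻¹ * Bᵀ * P t)) ?_ hK.feedback
    fun_prop
  have hgen := lqrB_generates hlt hR hKc hPc hP hPK hPc hP hPK
  have hA := solvesOneA_iff hB hF hK
  have hex : ∀ Pb : ℝ → Matrix (Fin m) (Fin m) ℝ,
      (∃ R', SolvesOneA t₀ t_f A B K Q F R' ∧ ∀ t ∈ Icc t₀ t_f, Pb t = R') ↔
        ∀ t ∈ Icc t₀ t_f, Pb t = R := fun Pb => by
    simp only [hA, exists_eq_left]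
  refine ⟨fun t ht => ⟨rank_gain_eq hB hR (hP t ht) (hPK t ht), hP t ht, ?_⟩, hgen,
    fun Pb => ⟨fun h t ht => h.eqOn hgen.regular hgen.riccati t ht,
      fun h => hgen.riccati.congr hgen.regular h⟩,
    lqrB_isOptimalFeedback hlt hKc hPc hP hR.isSymm hPK, hA, fun Pb => ?_, fun S => ?_⟩
  · simpa using (hP t ht).conjTranspose_mul_mul_same (Matrix.mulVec_injective_of_rank_eq hB)
  · rw [hex]
    refine ⟨⟨?_, fun h => ⟨_, hgen.congr h⟩⟩, ⟨?_, fun h => ⟨_, hgen.congr h⟩⟩,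
      ⟨?_, fun h => ⟨_, _, hgen.congr h⟩⟩⟩
    · rintro ⟨_, h⟩
      exact lqrB_riccatiSolution_eq_of_generates hB hR hP hPK h
    · rintro ⟨_, h⟩
      exact lqrB_riccatiSolution_eq_of_generates hB hR hP hPK h
    · rintro ⟨_, _, h⟩
      exact lqrB_riccatiSolution_eq_of_generates hB hR hP hPK h
  · have hOneB := solvesOneB_iff (S := S) hlt hR hKc hPc hP hPK
    refine ⟨hOneB, ⟨?_, ?_⟩, ⟨?_, ?_⟩⟩
    · rintro ⟨⟨F', h⟩, hS⟩
      -- The terminal cost is the terminal value of `S`; its positivity is what makes `S` positive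
      -- definite on the whole horizon.
      have hF' : F'.PosDef := (show S t_f = F' from h.riccati.2) ▸ hS
      exact ⟨solvesOneB_of_lqrA_generates hlt hR hKc hPc hP hPK hF' h, F', h.regular, h.riccati⟩
    · rintro ⟨h, F', hreg', hS⟩
      have hS' := (hOneB.1 h).2
      exact ⟨⟨F', hreg', hS, fun t ht => (lqrA_feedback_iff hR t).2 (hS' t ht).2⟩,
        (hS' t_f ⟨hlt.le, le_rfl⟩).1⟩
    · rintro ⟨Q', h⟩
      exact ⟨solvesOneB_of_lqrA_generates hlt hR hKc hPc hP hPK hF h, Q', h.regular, h.riccati⟩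
    · rintro ⟨h, Q', hreg', hS⟩
      exact ⟨Q', hreg', hS, fun t ht => (lqrA_feedback_iff hR t).2 ((hOneB.1 h).2 t ht).2⟩
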